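/- Let $n\ge 1$. A convex body in $\mathbb{R}^n$ is a nonempty compact convex subset of $\mathbb{R}^n$ (possibly with empty interior). For a unit vector $u$, the Steiner symmetral $s_uK$ of a convex body $K$ is obtained by replacing every nonempty chord $K\cap(x+\mathbb{R}u)$, $x\in u^\perp$, by the closed segment of the same length on the line $x+\mathbb{R}u$ whose midpoint is $x$; it is again a convex body. Let $\Omega$ be any dense subset of the unit sphere $S^{n-1}$ and let $K$ be any convex body in $\mathbb{R}^n$. Then there is a sequence $u_1,u_2,\dots$ of elements of $\Omega$ such that the iterated Steiner symmetrals $$K_m=s_{u_m}\cdots s_{u_1}K$$ converge, as $m\to\infty$, in the Hausdorff metric to the closed Euclidean ball centered at the origin that has the same $n$-dimensional volume as $K$. In particular, when $K$ has volume zero, the limit is a single point, namely the origin (the centered ball of radius zero). -/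

import Mathlib

namespace Steiner

variable {E : Type*} [NormedAddCommGroup E] [InnerProductSpace ℝ E]

/-- The chord that the set `K` cuts out of the line through `x` in the direction `u`, written in the
arc-length parameter of that line (for a unit vector `u`). -/
def chord (u : E) (K : Set E) (x : E) : Set ℝ :=
  {s | x + s • u ∈ K}

/-- The Steiner symmetral of `K` in the direction of the unit vector `u`: every nonempty chord of `K`
parallel to `u` is replaced by the closed segment of the same length, on the same line, that is
centered at the point `x` where the line meets the hyperplane orthogonal to `u`. -/
def symmetralSet (u : E) (K : Set E) : Set E :=
  {y | ∃ (x : E) (t : ℝ), inner ℝ u x = 0 ∧ (chord u K x).Nonempty ∧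
    |t| ≤ (MeasureTheory.volume (chord u K x)).toReal / 2 ∧ y = x + t • u}

theorem chord_eq_Icc (u : Metric.sphere (0 : E) 1) (K : ConvexBody E) (x : E)
    (h : (chord (u : E) (K : Set E) x).Nonempty) :
    ∃ a b : ℝ, a ≤ b ∧ chord (u : E) (K : Set E) x = Set.Icc a b := by
  have hu : ‖(u : E)‖ = 1 := by simp
  have hcont : Continuous (fun s : ℝ => x + s • (u : E)) := by fun_prop
  have hclosed : IsClosed (chord (u : E) (K : Set E) x) :=
    K.isCompact.isClosed.preimage hcont
  have hbdd : Bornology.IsBounded (chord (u : E) (K : Set E) x) := by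
    obtain ⟨R, hR⟩ := K.isCompact.isBounded.exists_norm_le
    refine isBounded_iff_forall_norm_le.2 ⟨R + ‖x‖, fun s hs => ?_⟩
    have h1 := hR _ hs
    have h2 : ‖s • (u : E)‖ = ‖s‖ := by rw [norm_smul, hu, mul_one]
    have h3 : ‖(x + s • (u : E)) - x‖ ≤ ‖x + s • (u : E)‖ + ‖x‖ := norm_sub_le _ _
    rw [add_sub_cancel_left, h2] at h3
    linarith
  have hconv : Convex ℝ (chord (u : E) (K : Set E) x) := by
    intro s hs t ht a b ha hb hab
    have := K.convex hs ht ha hb hab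
    have e : x + (a • s + b • t) • (u : E) = a • (x + s • (u : E)) + b • (x + t • (u : E)) := by
      have : x = (a + b) • x := by rw [hab, one_smul]
      nth_rewrite 1 [this]
      simp only [smul_eq_mul]
      module
    change x + (a • s + b • t) • (u : E) ∈ (K : Set E)
    rw [e]
    exact this
  have hcpt : IsCompact (chord (u : E) (K : Set E) x) :=
    Metric.isCompact_of_isClosed_isBounded hclosed hbdd
  have := eq_Icc_of_connected_compact ⟨h, hconv.isPreconnected⟩ hcpt
  refine ⟨_, _, ?_, this⟩
  rw [this] at h
  exact Set.nonempty_Icc.1 h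

/-- For convex bodies, the symmetral in terms of pairs of points on the same chord. -/
theorem mem_symmetralSet_iff (u : Metric.sphere (0 : E) 1) (K : ConvexBody E) (y : E) :
    y ∈ symmetralSet (u : E) (K : Set E) ↔
      ∃ (x : E) (a b : ℝ), inner ℝ (u : E) x = 0 ∧ x + a • (u : E) ∈ K ∧ x + b • (u : E) ∈ K ∧
        y = x + ((a - b) / 2) • (u : E) := by
  constructor
  · rintro ⟨x, t, hx, hne, ht, rfl⟩
    obtain ⟨a, b, hab, hI⟩ := chord_eq_Icc u K x hne
    rw [hI, Real.volume_Icc, ENNReal.toReal_ofReal (by linarith)] at ht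
    obtain ⟨ht1, ht2⟩ := abs_le.1 ht
    have m1 : (a + b) / 2 + t ∈ chord (u : E) (K : Set E) x := by
      rw [hI]; constructor <;> linarith
    have m2 : (a + b) / 2 - t ∈ chord (u : E) (K : Set E) x := by
      rw [hI]; constructor <;> linarith
    exact ⟨x, _, _, hx, m1, m2, by congr 2; ring⟩
  · rintro ⟨x, a, b, hx, ha, hb, rfl⟩
    have hne : (chord (u : E) (K : Set E) x).Nonempty := ⟨a, ha⟩
    obtain ⟨p, q, hpq, hI⟩ := chord_eq_Icc u K x hne
    refine ⟨x, _, hx, hne, ?_, rfl⟩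
    have ha' : a ∈ chord (u : E) (K : Set E) x := ha
    have hb' : b ∈ chord (u : E) (K : Set E) x := hb
    rw [hI] at ha' hb' ⊢
    rw [Real.volume_Icc, ENNReal.toReal_ofReal (by linarith), abs_le]
    constructor <;> linarith [ha'.1, ha'.2, hb'.1, hb'.2]

theorem convex_symmetralSet (u : Metric.sphere (0 : E) 1) (K : ConvexBody E) :
    Convex ℝ (symmetralSet (u : E) (K : Set E)) := by
  intro y hy z hz α β hα hβ hαβ
  rw [mem_symmetralSet_iff] at hy hz ⊢
  obtain ⟨x, a, b, hx, ha, hb, rfl⟩ := hy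
  obtain ⟨x', a', b', hx', ha', hb', rfl⟩ := hz
  refine ⟨α • x + β • x', α * a + β * a', α * b + β * b', ?_, ?_, ?_, ?_⟩
  · rw [inner_add_right, inner_smul_right, inner_smul_right, hx, hx']; simp
  · have e : α • x + β • x' + (α * a + β * a') • (u : E) =
        α • (x + a • (u : E)) + β • (x' + a' • (u : E)) := by module
    rw [e]
    exact K.convex ha ha' hα hβ hαβ
  · have e : α • x + β • x' + (α * b + β * b') • (u : E) =
        α • (x + b • (u : E)) + β • (x' + b' • (u : E)) := by module
    rw [e]
    exact K.convex hb hb' hα hβ hαβ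
  · module

theorem isCompact_symmetralSet (u : Metric.sphere (0 : E) 1) (K : ConvexBody E) :
    IsCompact (symmetralSet (u : E) (K : Set E)) := by
  have huu : inner ℝ (u : E) (u : E) = 1 := by
    rw [real_inner_self_eq_norm_sq]; simp
  let P : E → E := fun p => p - (inner ℝ (u : E) p) • (u : E)
  have hP : Continuous P := by fun_prop
  have hC : IsCompact (((K : Set E) ×ˢ (K : Set E)) ∩ {pq : E × E | P pq.1 = P pq.2}) :=
    (K.isCompact.prod K.isCompact).inter_right
      (isClosed_eq (hP.comp continuous_fst) (hP.comp continuous_snd))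
  let F : E × E → E := fun pq =>
    P pq.1 + ((inner ℝ (u : E) pq.1 - inner ℝ (u : E) pq.2) / 2) • (u : E)
  have hF : Continuous F := by fun_prop
  convert hC.image hF using 1
  ext y
  rw [mem_symmetralSet_iff]
  constructor
  · rintro ⟨x, a, b, hx, ha, hb, rfl⟩
    have hi : ∀ c : ℝ, inner ℝ (u : E) (x + c • (u : E)) = c := fun c => by
      rw [inner_add_right, inner_smul_right, hx, huu]; ring
    refine ⟨(x + a • (u : E), x + b • (u : E)), ⟨⟨ha, hb⟩, ?_⟩, ?_⟩
    · simp only [P, Set.mem_ofPred_eq, hi]; module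
    · simp only [F, P, hi]; module
  · rintro ⟨⟨p, q⟩, ⟨⟨hp, hq⟩, hpq⟩, rfl⟩
    have hpq' : P p = P q := hpq
    refine ⟨P p, inner ℝ (u : E) p, inner ℝ (u : E) q, ?_, ?_, ?_, rfl⟩
    · simp only [P, inner_sub_right, inner_smul_right, huu]; ring
    · have : P p + (inner ℝ (u : E) p) • (u : E) = p := by simp [P]
      rw [this]; exact hp
    · have : P q + (inner ℝ (u : E) q) • (u : E) = q := by simp [P]
      rw [hpq', this]; exact hq

theorem nonempty_symmetralSet (u : Metric.sphere (0 : E) 1) (K : ConvexBody E) :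
    (symmetralSet (u : E) (K : Set E)).Nonempty := by
  obtain ⟨p, hp⟩ := K.nonempty
  have huu : inner ℝ (u : E) (u : E) = 1 := by
    rw [real_inner_self_eq_norm_sq]; simp
  have h : p - (inner ℝ (u : E) p) • (u : E) + (inner ℝ (u : E) p) • (u : E) ∈ K := by
    simpa using hp
  refine ⟨_, (mem_symmetralSet_iff u K _).2
    ⟨p - (inner ℝ (u : E) p) • (u : E), _, _, ?_, h, h, rfl⟩⟩
  rw [inner_sub_right, inner_smul_right, huu]; ring

/-- The Steiner symmetrization `s_u K` of a convex body (a nonempty compact convex set). -/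
def symmetral (u : Metric.sphere (0 : E) 1) (K : ConvexBody E) : ConvexBody E where
  carrier := symmetralSet (u : E) (K : Set E)
  convex' := convex_symmetralSet u K
  isCompact' := isCompact_symmetralSet u K
  nonempty' := nonempty_symmetralSet u K

/-- The iterated symmetral `s_{u_{m-1}} ⋯ s_{u_0} K`, for `m` successive directions. -/
def iteratedSymmetral (u : ℕ → Metric.sphere (0 : E) 1) (K : ConvexBody E) : ℕ → ConvexBody E
  | 0 => K
  | m + 1 => symmetral (u m) (iteratedSymmetral u K m)

/-- The closed Euclidean ball of radius `r` centered at the origin, as a convex body; for `r = 0` it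
is the one-point set consisting of the origin. -/
def centeredBall (n : ℕ) (r : NNReal) : ConvexBody (EuclideanSpace ℝ (Fin n)) where
  carrier := Metric.closedBall 0 r
  convex' := convex_closedBall 0 (r : ℝ)
  isCompact' := isCompact_closedBall 0 (r : ℝ)
  nonempty' := Metric.nonempty_closedBall.2 r.2

end Steiner

/-! Let `F` be the integral of `exp(h_K)` over the unit ball (`expMean`), `h_K` being the support
function. The symmetral lies in the Minkowski average of `K` and its mirror image, so its support
function is at most the mean of `h_K` and the reflected `h_K`. Strict convexity of `exp` then makes
`F` drop by at least an integrated square (`expMean_symmetral_add_le`); no drop forces `h_K` to be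
reflection invariant.

Choose each direction in `Ω` to minimize `F` of the next body up to `1/(m+1)`. All iterates lie in
one ball, so Blaschke selection gives cluster points `L`. No `w ∈ Ω` lowers `F` at `L`
(`expMean_le_symmetral_of_tendsto`), so `h_L` is invariant under a dense set of reflections and `L`
is a centered ball. Volume is preserved and determines the radius, so all cluster points coincide
and the whole sequence converges.

Symmetrization can be discontinuous at bodies with empty interior. Only upper semicontinuity is
needed, because `F` is monotone under inclusion; this covers volume zero as well. -/

namespace Steiner

open Metric Filter Topology MeasureTheory

/-! ### Support functions, reflections and semicontinuity of symmetrization -/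

section Support

variable {E : Type*} [NormedAddCommGroup E] [InnerProductSpace ℝ E]

/-- The support function of a convex body. -/
noncomputable def supp (K : ConvexBody E) (v : E) : ℝ :=
  sSup ((fun x => inner ℝ x v) '' (K : Set E))

theorem inner_le_supp {K : ConvexBody E} {x : E} (hx : x ∈ K) (v : E) :
    inner ℝ x v ≤ supp K v :=
  le_csSup (K.isCompact.image (by fun_prop)).bddAbove ⟨x, hx, rfl⟩

theorem supp_le {K : ConvexBody E} {v : E} {c : ℝ} (h : ∀ x ∈ K, inner ℝ x v ≤ c) :
    supp K v ≤ c :=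
  csSup_le (K.nonempty.image _) (by rintro _ ⟨x, hx, rfl⟩; exact h x hx)

theorem exists_dist_le (K L : ConvexBody E) {x : E} (hx : x ∈ K) :
    ∃ y ∈ L, dist x y ≤ dist K L := by
  obtain ⟨y, hy, h⟩ := L.isCompact.exists_infDist_eq_dist L.nonempty x
  refine ⟨y, hy, h ▸ ?_⟩
  rw [← ConvexBody.hausdorffDist_coe]
  exact infDist_le_hausdorffDist_of_mem hx ConvexBody.hausdorffEDist_ne_top

/-- If `K` lies in the `δ`-neighborhood of `L`, then `h_K ≤ h_L + δ‖·‖`. -/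
theorem supp_le_supp_add {K L : ConvexBody E} {δ : ℝ}
    (h : ∀ x ∈ K, ∃ y ∈ L, dist x y ≤ δ) (v : E) : supp K v ≤ supp L v + δ * ‖v‖ := by
  refine supp_le fun x hx => ?_
  obtain ⟨y, hy, hxy⟩ := h x hx
  have h1 : inner ℝ x v = inner ℝ y v + inner ℝ (x - y) v := by rw [inner_sub_left]; ring
  have h2 : inner ℝ (x - y) v ≤ ‖x - y‖ * ‖v‖ := real_inner_le_norm _ _
  have h3 : ‖x - y‖ * ‖v‖ ≤ δ * ‖v‖ := by
    rw [← dist_eq_norm]; gcongr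
  linarith [inner_le_supp hy v]

theorem supp_smul (K : ConvexBody E) {c : ℝ} (hc : 0 < c) (v : E) :
    supp K (c • v) = c * supp K v := by
  apply le_antisymm
  · refine supp_le fun x hx => ?_
    rw [inner_smul_right]
    exact mul_le_mul_of_nonneg_left (inner_le_supp hx v) hc.le
  · rw [← le_div_iff₀' hc]
    refine supp_le fun x hx => ?_
    rw [le_div_iff₀' hc]
    simpa [inner_smul_right] using inner_le_supp hx (c • v)

theorem continuous_supp (K : ConvexBody E) : Continuous (supp K) := by
  obtain ⟨R, hR⟩ := K.isCompact.isBounded.exists_norm_le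
  have key : ∀ v w, supp K v ≤ supp K w + R * dist v w := fun v w => by
    refine supp_le fun x hx => ?_
    have h1 : inner ℝ x v = inner ℝ x w + inner ℝ x (v - w) := by rw [inner_sub_right]; ring
    have h2 : inner ℝ x (v - w) ≤ ‖x‖ * ‖v - w‖ := real_inner_le_norm _ _
    have h3 : ‖x‖ * ‖v - w‖ ≤ R * dist v w := by
      rw [← dist_eq_norm]; gcongr; exact hR x hx
    linarith [inner_le_supp hx w]
  exact (LipschitzWith.of_le_add_mul' R key).continuous

theorem continuous_exp_supp (K : ConvexBody E) : Continuous fun v => Real.exp (supp K v) :=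
  Real.continuous_exp.comp (continuous_supp K)

theorem exists_supp_lt_inner [CompleteSpace E] {K : ConvexBody E} {x : E} (hx : x ∉ K) :
    ∃ v, supp K v < inner ℝ x v := by
  obtain ⟨f, c, h1, h2⟩ := geometric_hahn_banach_closed_point K.convex K.isClosed hx
  have hf : ∀ y, inner ℝ y ((InnerProductSpace.toDual ℝ E).symm f) = f y := fun y => by
    rw [real_inner_comm, InnerProductSpace.toDual_symm_apply]
  refine ⟨(InnerProductSpace.toDual ℝ E).symm f, ?_⟩
  rw [hf]
  exact (supp_le fun y hy => by rw [hf]; exact (h1 y hy).le).trans_lt h2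

/-- The reflection in the hyperplane orthogonal to `u`. -/
noncomputable def refl (u : sphere (0 : E) 1) : E ≃ₗᵢ[ℝ] E :=
  (ℝ ∙ (u : E))ᗮ.reflection

theorem refl_apply (u : sphere (0 : E) 1) (x : E) :
    refl u x = x - (2 * inner ℝ (u : E) x) • (u : E) := by
  rw [refl, Submodule.reflection_orthogonal_apply, Submodule.reflection_singleton_apply]
  simp
  module

theorem refl_refl (u : sphere (0 : E) 1) (x : E) : refl u (refl u x) = x :=
  Submodule.reflection_reflection _ _

theorem inner_refl_left (u : sphere (0 : E) 1) (x y : E) :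
    inner ℝ (refl u x) y = inner ℝ x (refl u y) := by
  rw [← (refl u).inner_map_map, refl_refl]

/-- Coordinate-free form: points of the symmetral are midpoints of `p` and the mirror image of `q`,
for `p`, `q` on one chord. It exhibits the symmetral inside a Minkowski average, and the chord
condition is closed, hence stable under limits. -/
theorem mem_symmetral_iff (u : sphere (0 : E) 1) (K : ConvexBody E) (y : E) :
    y ∈ symmetral u K ↔ ∃ p ∈ K, ∃ q ∈ K, p - q = inner ℝ (u : E) (p - q) • (u : E) ∧
      y = (1 / 2 : ℝ) • (p + refl u q) := by
  have huu : inner ℝ (u : E) (u : E) = 1 := by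
    rw [real_inner_self_eq_norm_sq]; simp
  refine (mem_symmetralSet_iff u K y).trans ⟨?_, ?_⟩
  · rintro ⟨x, a, b, hx, ha, hb, rfl⟩
    refine ⟨_, ha, _, hb, ?_, ?_⟩
    · simp only [inner_sub_right, inner_add_right, inner_smul_right, huu, hx]
      module
    · rw [refl_apply]
      simp only [inner_add_right, inner_smul_right, huu, hx]
      module
  · rintro ⟨p, hp, q, hq, hpq, rfl⟩
    have hp' : q - inner ℝ (u : E) q • (u : E) + inner ℝ (u : E) p • (u : E) = p := by
      have : p = (p - q) + q := by abel
      rw [this, hpq]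
      simp only [inner_sub_right, inner_add_right, inner_smul_right, huu]
      module
    refine ⟨q - inner ℝ (u : E) q • (u : E), inner ℝ (u : E) p, inner ℝ (u : E) q, ?_, ?_, ?_, ?_⟩
    · simp [inner_sub_right, inner_smul_right]
    · rw [hp']; exact hp
    · rw [sub_add_cancel]; exact hq
    · rw [refl_apply]
      nth_rewrite 1 [← hp']
      module

theorem norm_le_of_mem_symmetral {u : sphere (0 : E) 1} {K : ConvexBody E} {R : ℝ}
    (hK : ∀ x ∈ K, ‖x‖ ≤ R) : ∀ y ∈ symmetral u K, ‖y‖ ≤ R := by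
  intro y hy
  obtain ⟨p, hp, q, hq, -, rfl⟩ := (mem_symmetral_iff u K y).1 hy
  have h1 := norm_add_le p (refl u q)
  rw [(refl u).norm_map] at h1
  rw [norm_smul, Real.norm_of_nonneg (by norm_num)]
  linarith [hK p hp, hK q hq]

theorem supp_symmetral_le (u : sphere (0 : E) 1) (K : ConvexBody E) (v : E) :
    supp (symmetral u K) v ≤ (supp K v + supp K (refl u v)) / 2 := by
  refine supp_le fun y hy => ?_
  obtain ⟨p, hp, q, hq, -, rfl⟩ := (mem_symmetral_iff u K y).1 hy
  rw [real_inner_smul_left, inner_add_left, inner_refl_left]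
  linarith [inner_le_supp hp v, inner_le_supp hq (refl u v)]

/-- Symmetrization in a fixed direction is upper semicontinuous. -/
theorem eventually_symmetral_subset (u : sphere (0 : E) 1) {K : ℕ → ConvexBody E}
    {L : ConvexBody E} (hK : Tendsto K atTop (𝓝 L)) {δ : ℝ} (hδ : 0 < δ) :
    ∀ᶠ j in atTop, ∀ y ∈ symmetral u (K j), ∃ z ∈ symmetral u L, dist y z ≤ δ := by
  by_contra hcon
  obtain ⟨φ, hφ, hbad⟩ := extraction_of_frequently_atTop (not_eventually.1 hcon)
  push Not at hbad
  choose y hy hfar using hbad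
  choose p hp q hq hpq hyp using fun j => (mem_symmetral_iff u (K (φ j)) (y j)).1 (hy j)
  have hd : Tendsto (fun j => dist (K (φ j)) L) atTop (𝓝 0) :=
    (tendsto_iff_dist_tendsto_zero.1 hK).comp hφ.tendsto_atTop
  choose p' hp' hpp' using fun j => exists_dist_le (K (φ j)) L (hp j)
  choose q' hq' hqq' using fun j => exists_dist_le (K (φ j)) L (hq j)
  -- The nearby pairs in the compact `L × L` cluster at `(a, b)`; the bad points `y` then cluster at
  -- a point of the symmetral of `L`, a contradiction.
  obtain ⟨⟨a, b⟩, ⟨ha, hb⟩, ψ, hψ, hlim⟩ :=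
    (L.isCompact.prod L.isCompact).tendsto_subseq (x := fun j => (p' j, q' j))
      fun j => ⟨hp' j, hq' j⟩
  have hd' := hd.comp hψ.tendsto_atTop
  have lim_of : ∀ {f f' : ℕ → E} {c : E}, (∀ j, dist (f j) (f' j) ≤ dist (K (φ j)) L) →
      Tendsto (f' ∘ ψ) atTop (𝓝 c) → Tendsto (f ∘ ψ) atTop (𝓝 c) := fun {f f' c} h hf' => by
    have h0 : Tendsto (fun j => dist ((f' ∘ ψ) j) ((f ∘ ψ) j)) atTop (𝓝 0) :=
      squeeze_zero (fun _ => dist_nonneg) (fun j => by rw [dist_comm]; exact h (ψ j)) hd'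
    exact (tendsto_iff_of_dist h0).1 hf'
  have hpa : Tendsto (p ∘ ψ) atTop (𝓝 a) :=
    lim_of hpp' ((continuous_fst.tendsto _).comp hlim)
  have hqb : Tendsto (q ∘ ψ) atTop (𝓝 b) :=
    lim_of hqq' ((continuous_snd.tendsto _).comp hlim)
  have hab : a - b = inner ℝ (u : E) (a - b) • (u : E) := by
    have h1 : Tendsto (fun j => p (ψ j) - q (ψ j)) atTop (𝓝 (a - b)) := hpa.sub hqb
    have hc : Continuous fun z : E => inner ℝ (u : E) z • (u : E) := by fun_prop
    have h2 := (hc.tendsto _).comp h1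
    refine tendsto_nhds_unique h1 (h2.congr fun j => ?_)
    exact (hpq (ψ j)).symm
  have hylim : Tendsto (y ∘ ψ) atTop (𝓝 ((1 / 2 : ℝ) • (a + refl u b))) := by
    have := (hpa.add (((refl u).continuous.tendsto _).comp hqb)).const_smul (1 / 2 : ℝ)
    refine this.congr fun j => ?_
    simp [hyp]
  have hmem : (1 / 2 : ℝ) • (a + refl u b) ∈ symmetral u L :=
    (mem_symmetral_iff u L _).2 ⟨a, ha, b, hb, hab, rfl⟩
  obtain ⟨j, hj⟩ := ((tendsto_iff_dist_tendsto_zero.1 hylim).eventually_lt_const hδ).exists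
  exact absurd (hfar (ψ j) _ hmem) (not_lt.2 hj.le)

end Support

/-! ### Invariance of volume -/

section Volume

variable {E : Type*} [NormedAddCommGroup E] [InnerProductSpace ℝ E] [FiniteDimensional ℝ E]
  [MeasurableSpace E] [BorelSpace E]

/-- Fubini's theorem along the lines parallel to `u`. -/
theorem volume_eq_lintegral_chord (u : sphere (0 : E) 1) {A : Set E} (hA : MeasurableSet A) :
    volume A = ∫⁻ z : (ℝ ∙ (u : E))ᗮ, volume (chord (u : E) A z) := by
  have hu : ‖(u : E)‖ = 1 := by simp
  let S : Submodule ℝ E := ℝ ∙ (u : E)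
  have h1 : MeasurePreserving S.orthogonalDecomposition.symm :=
    S.orthogonalDecomposition.symm.measurePreserving
  have h2 := h1.comp (WithLp.volume_preserving_toLp S Sᗮ)
  have hm := hA.preimage h2.measurable
  rw [← h2.measure_preimage hA.nullMeasurableSet, Measure.volume_eq_prod,
    Measure.prod_apply_symm hm]
  refine lintegral_congr fun z => ?_
  have h3 := (LinearIsometryEquiv.toSpanUnitSingleton (𝕜 := ℝ) (u : E) hu).measurePreserving
  rw [← h3.measure_preimage (hm.preimage measurable_prodMk_right).nullMeasurableSet]
  congr 1
  ext t
  simp [chord, S, add_comm]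

/-- Corresponding chords have equal length, so Fubini applies (Cavalieri's principle). -/
theorem volume_symmetral (u : sphere (0 : E) 1) (K : ConvexBody E) :
    volume (symmetral u K : Set E) = volume (K : Set E) := by
  rw [volume_eq_lintegral_chord u (symmetral u K).isClosed.measurableSet,
    volume_eq_lintegral_chord u K.isClosed.measurableSet]
  refine lintegral_congr fun z => ?_
  have huu : inner ℝ (u : E) (u : E) = 1 := by
    rw [real_inner_self_eq_norm_sq]; simp
  have hz : inner ℝ (u : E) (z : E) = 0 :=
    Submodule.mem_orthogonal_singleton_iff_inner_right.1 z.2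
  have hmem : ∀ t, t ∈ chord (u : E) (symmetral u K : Set E) z ↔
      (chord (u : E) (K : Set E) z).Nonempty ∧
        |t| ≤ (volume (chord (u : E) (K : Set E) z)).toReal / 2 := by
    intro t
    constructor
    · rintro ⟨x, s, hx, hne, hs, he⟩
      have hst : t = s := by
        have := congrArg (inner ℝ (u : E)) he
        simpa [inner_add_right, inner_smul_right, hz, hx, huu] using this
      have hzx : (z : E) = x := by
        rw [hst] at he
        exact add_right_cancel he
      rw [hzx, hst]
      exact ⟨hne, hs⟩
    · rintro ⟨hne, ht⟩
      exact ⟨z, t, hz, hne, ht, rfl⟩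
  rcases (chord (u : E) (K : Set E) z).eq_empty_or_nonempty with he | hne
  · rw [he] at hmem ⊢
    congr 1
    ext t
    simp [hmem]
  · obtain ⟨a, b, hab, hI⟩ := chord_eq_Icc u K z hne
    have hS : chord (u : E) (symmetral u K : Set E) z = Set.Icc (-((b - a) / 2)) ((b - a) / 2) := by
      ext t
      rw [hmem, hI, Real.volume_Icc, ENNReal.toReal_ofReal (by linarith), Set.mem_Icc, abs_le]
      simp [hab]
    rw [hS, hI, Real.volume_Icc, Real.volume_Icc]
    congr 1
    ring

theorem volume_iteratedSymmetral (u : ℕ → sphere (0 : E) 1) (K : ConvexBody E) (m : ℕ) :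
    volume (iteratedSymmetral u K m : Set E) = volume (K : Set E) := by
  induction m with
  | zero => rfl
  | succ m ih => exact (volume_symmetral _ _).trans ih

end Volume

/-! ### The strictly decreasing functional -/

section Functional

variable {E : Type*} [NormedAddCommGroup E] [InnerProductSpace ℝ E] [FiniteDimensional ℝ E]
  [MeasurableSpace E] [BorelSpace E]

/-- The integral of the exponential of the support function over the unit ball. -/
noncomputable def expMean (K : ConvexBody E) : ℝ :=
  ∫ v in closedBall (0 : E) 1, Real.exp (supp K v)

theorem expMean_nonneg (K : ConvexBody E) : 0 ≤ expMean K :=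
  integral_nonneg fun _ => (Real.exp_pos _).le

theorem integrableOn_unitBall {f : E → ℝ} (hf : Continuous f) :
    IntegrableOn f (closedBall (0 : E) 1) :=
  hf.continuousOn.integrableOn_compact (isCompact_closedBall 0 1)

/-- On the unit ball `h_K ≤ h_L + δ`. The hypothesis is one-sided so that it fits upper
semicontinuity. -/
theorem expMean_le {K L : ConvexBody E} {δ : ℝ} (hδ : 0 ≤ δ)
    (h : ∀ x ∈ K, ∃ y ∈ L, dist x y ≤ δ) : expMean K ≤ Real.exp δ * expMean L := by
  rw [expMean, expMean, ← integral_const_mul]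
  refine setIntegral_mono_on (integrableOn_unitBall (continuous_exp_supp K))
    ((integrableOn_unitBall (continuous_exp_supp L)).const_mul _)
    isClosed_closedBall.measurableSet fun v hv => ?_
  rw [← Real.exp_add, Real.exp_le_exp]
  have h1 := supp_le_supp_add h v
  have h2 : δ * ‖v‖ ≤ δ * 1 := by
    gcongr; simpa using hv
  linarith

theorem tendsto_expMean {K : ℕ → ConvexBody E} {L : ConvexBody E}
    (hK : Tendsto K atTop (𝓝 L)) : Tendsto (fun j => expMean (K j)) atTop (𝓝 (expMean L)) := by
  have hd : Tendsto (fun j => dist (K j) L) atTop (𝓝 0) := tendsto_iff_dist_tendsto_zero.1 hK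
  have h1 : Tendsto (fun j => Real.exp (dist (K j) L) * expMean L) atTop (𝓝 (expMean L)) := by
    simpa using ((Real.continuous_exp.tendsto 0).comp hd).mul_const (expMean L)
  have h2 : Tendsto (fun j => Real.exp (-dist (K j) L) * expMean L) atTop (𝓝 (expMean L)) := by
    simpa using ((Real.continuous_exp.tendsto _).comp hd.neg).mul_const (expMean L)
  refine tendsto_of_tendsto_of_tendsto_of_le_of_le h2 h1 (fun j => ?_) fun j =>
    expMean_le dist_nonneg fun x hx => exists_dist_le _ _ hx
  have h3 : expMean L ≤ Real.exp (dist (K j) L) * expMean (K j) :=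
    expMean_le dist_nonneg fun x hx => dist_comm L (K j) ▸ exists_dist_le _ _ hx
  calc Real.exp (-dist (K j) L) * expMean L
      ≤ Real.exp (-dist (K j) L) * (Real.exp (dist (K j) L) * expMean (K j)) := by gcongr
    _ = expMean (K j) := by rw [← mul_assoc, ← Real.exp_add]; simp

theorem setIntegral_comp_refl (u : sphere (0 : E) 1) (f : E → ℝ) :
    ∫ v in closedBall (0 : E) 1, f (refl u v) = ∫ v in closedBall (0 : E) 1, f v := by
  have h := (refl u).measurePreserving.setIntegral_preimage_emb
    (refl u).toHomeomorph.measurableEmbedding f (closedBall (0 : E) 1)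
  rw [← h]
  congr 2
  ext v
  simp

/-- Quantitative monotonicity of `expMean` under symmetrization. -/
theorem expMean_symmetral_add_le (u : sphere (0 : E) 1) (K : ConvexBody E) :
    expMean (symmetral u K) + ∫ v in closedBall (0 : E) 1,
      (Real.exp (supp K v / 2) - Real.exp (supp K (refl u v) / 2)) ^ 2 / 2 ≤ expMean K := by
  have hc := continuous_supp K
  have hc' : Continuous fun v => supp K (refl u v) := hc.comp (refl u).continuous
  have hi : IntegrableOn (fun v => (Real.exp (supp K v / 2) -
      Real.exp (supp K (refl u v) / 2)) ^ 2 / 2) (closedBall (0 : E) 1) :=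
    integrableOn_unitBall (by fun_prop)
  have hi1 := integrableOn_unitBall (continuous_exp_supp K)
  have hi2 : IntegrableOn (fun v => Real.exp (supp K (refl u v))) (closedBall (0 : E) 1) :=
    integrableOn_unitBall (by fun_prop)
  have hK : expMean K = ∫ v in closedBall (0 : E) 1,
      (Real.exp (supp K v) + Real.exp (supp K (refl u v))) / 2 := by
    rw [integral_div, integral_add hi1 hi2, setIntegral_comp_refl u fun v => Real.exp (supp K v),
      expMean]
    ring
  rw [hK, expMean, ← integral_add (integrableOn_unitBall (continuous_exp_supp _)) hi]
  refine setIntegral_mono_on ((integrableOn_unitBall (continuous_exp_supp _)).add hi)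
    ((hi1.add hi2).div_const 2) isClosed_closedBall.measurableSet fun v _ => ?_
  -- With `a`, `b` the two support values, `exp((a+b)/2)` equals `(exp a + exp b)/2` minus half the
  -- square of `exp(a/2) - exp(b/2)`.
  have h1 : Real.exp (supp (symmetral u K) v) ≤
      Real.exp (supp K v / 2) * Real.exp (supp K (refl u v) / 2) := by
    rw [← Real.exp_add, Real.exp_le_exp]
    linarith [supp_symmetral_le u K v]
  have h2 : ∀ t, Real.exp t = Real.exp (t / 2) ^ 2 := fun t => by
    rw [← Real.exp_nat_mul]; congr 1; push_cast; ring
  rw [h2 (supp K v), h2 (supp K (refl u v))]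
  linarith

theorem expMean_symmetral_le (u : sphere (0 : E) 1) (K : ConvexBody E) :
    expMean (symmetral u K) ≤ expMean K := by
  refine le_trans ?_ (expMean_symmetral_add_le u K)
  exact le_add_of_nonneg_right (integral_nonneg fun v => by positivity)

/-- The square deficit integrates to zero, so it vanishes almost everywhere, and by continuity on
the whole open ball. Positive homogeneity extends the equality to all `v`. -/
theorem supp_refl_of_expMean_le {u : sphere (0 : E) 1} {K : ConvexBody E}
    (h : expMean K ≤ expMean (symmetral u K)) (v : E) : supp K (refl u v) = supp K v := by
  have hc := continuous_supp K
  have hc' : Continuous fun v => supp K (refl u v) := hc.comp (refl u).continuous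
  set g : E → ℝ := fun v =>
    (Real.exp (supp K v / 2) - Real.exp (supp K (refl u v) / 2)) ^ 2 / 2 with hg
  have hgc : Continuous g := by fun_prop
  have hg0 : ∀ v, 0 ≤ g v := fun v => by positivity
  have h0 : ∫ v in closedBall (0 : E) 1, g v = 0 :=
    le_antisymm (by linarith [expMean_symmetral_add_le u K]) (integral_nonneg hg0)
  have hae := (setIntegral_eq_zero_iff_of_nonneg_ae (ae_of_all _ hg0)
    (integrableOn_unitBall hgc)).1 h0
  have heq : Set.EqOn g 0 (ball (0 : E) 1) :=
    Measure.eqOn_open_of_ae_eq (ae_restrict_of_ae_restrict_of_subset ball_subset_closedBall hae)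
      isOpen_ball hgc.continuousOn continuousOn_const
  have hball : ∀ w ∈ ball (0 : E) 1, supp K (refl u w) = supp K w := fun w hw => by
    have h1 : g w = 0 := heq hw
    have h2 : Real.exp (supp K w / 2) = Real.exp (supp K (refl u w) / 2) := by
      simpa [hg, sub_eq_zero] using h1
    linarith [Real.exp_injective h2]
  have hpos : 0 < (‖v‖ + 1)⁻¹ := by positivity
  have := hball ((‖v‖ + 1)⁻¹ • v) (by
    rw [mem_ball_zero_iff, norm_smul, Real.norm_of_nonneg hpos.le, inv_mul_lt_iff₀ (by positivity)]
    linarith)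
  rw [map_smul, supp_smul K hpos, supp_smul K hpos] at this
  exact mul_left_cancel₀ hpos.ne' this

end Functional

/-! ### Reflection-invariant bodies and compactness -/

section Limit

variable {E : Type*} [NormedAddCommGroup E] [InnerProductSpace ℝ E]

/-- A support function invariant under a dense set of reflections is constant on the sphere. -/
theorem supp_eq_of_refl_invariant {Ω : Set (sphere (0 : E) 1)} (hΩ : Dense Ω)
    {L : ConvexBody E} (h : ∀ u ∈ Ω, ∀ v, supp L (refl u v) = supp L v) {v w : E}
    (hvw : ‖v‖ = ‖w‖) : supp L v = supp L w := by
  rcases eq_or_ne v w with rfl | hne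
  · rfl
  have hall : ∀ u, supp L (refl u v) = supp L v := by
    have hcl : IsClosed {u : sphere (0 : E) 1 | supp L (refl u v) = supp L v} := by
      refine isClosed_eq ((continuous_supp L).comp ?_) continuous_const
      simp only [refl_apply]
      fun_prop
    have : closure Ω ⊆ {u : sphere (0 : E) 1 | supp L (refl u v) = supp L v} :=
      closure_minimal (fun u hu => h u hu v) hcl
    exact fun u => this (hΩ u)
  have hd : ‖v - w‖ ≠ 0 := norm_ne_zero_iff.2 (sub_ne_zero.2 hne)
  -- Vectors of equal norm are exchanged by the reflection along their difference.
  let u : sphere (0 : E) 1 := ⟨‖v - w‖⁻¹ • (v - w), by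
    rw [mem_sphere_zero_iff_norm, norm_smul, norm_inv, norm_norm, inv_mul_cancel₀ hd]⟩
  have hu : refl u v = w := by
    have hspan : (ℝ ∙ (u : E)) = ℝ ∙ (v - w) :=
      Submodule.span_singleton_smul_eq (IsUnit.mk0 _ (inv_ne_zero hd)) _
    have : ∀ (S T : Submodule ℝ E) [S.HasOrthogonalProjection] [T.HasOrthogonalProjection],
        S = T → Sᗮ.reflection v = Tᗮ.reflection v := by
      rintro S T _ _ rfl; rfl
    rw [refl, this _ _ hspan, Submodule.reflection_sub hvw]
  rw [← hall u, hu]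

/-- The Blaschke selection theorem. -/
theorem exists_tendsto_subseq [FiniteDimensional ℝ E] (K : ℕ → ConvexBody E) {R : ℝ}
    (hR : ∀ j, ∀ x ∈ K j, ‖x‖ ≤ R) :
    ∃ (L : ConvexBody E) (φ : ℕ → ℕ), StrictMono φ ∧ Tendsto (K ∘ φ) atTop (𝓝 L) := by
  have : ProperSpace E := FiniteDimensional.proper ℝ E
  have hsub : ∀ j, (K j : Set E) ⊆ closedBall 0 R := fun j x hx => by simpa using hR j x hx
  have himg : ∀ j, (↑) '' ((↑) ⁻¹' (K j : Set E) : Set (closedBall (0 : E) R)) = (K j : Set E) :=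
    fun j => by rw [Subtype.image_preimage_coe, Set.inter_eq_right.2 (hsub j)]
  have : CompactSpace (closedBall (0 : E) R) :=
    isCompact_iff_compactSpace.1 (isCompact_closedBall 0 R)
  -- Nonempty compact subsets of a compact space form a compact space; it remains to see that the
  -- limit set is convex.
  let C : ℕ → TopologicalSpace.NonemptyCompacts (closedBall (0 : E) R) := fun j =>
    { carrier := (↑) ⁻¹' (K j : Set E)
      isCompact' := ((K j).isClosed.preimage continuous_subtype_val).isCompact
      nonempty' := by
        obtain ⟨x, hx⟩ := (K j).nonempty
        exact ⟨⟨x, hsub j hx⟩, hx⟩ }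
  obtain ⟨M, φ, hφ, hlim⟩ := CompactSpace.tendsto_subseq C
  have hdist : ∀ j, hausdorffDist (K j : Set E) ((↑) '' (M : Set (closedBall (0 : E) R))) =
      dist (C j) M := fun j => by
    rw [NonemptyCompacts.dist_eq,
      ← hausdorffDist_image (isometry_subtype_coe (s := closedBall (0 : E) R))]
    congr 1
    exact (himg j).symm
  have hMc : IsCompact ((↑) '' (M : Set (closedBall (0 : E) R)) : Set E) :=
    M.isCompact.image continuous_subtype_val
  have hMn : ((↑) '' (M : Set (closedBall (0 : E) R)) : Set E).Nonempty := M.nonempty.image _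
  have hfin : ∀ j, hausdorffEDist (K j : Set E) ((↑) '' (M : Set (closedBall (0 : E) R))) ≠ ⊤ :=
    fun j => hausdorffEDist_ne_top_of_nonempty_of_bounded (K j).nonempty hMn
      (K j).isCompact.isBounded hMc.isBounded
  have hconv : Convex ℝ ((↑) '' (M : Set (closedBall (0 : E) R)) : Set E) := by
    intro x hx y hy a b ha hb hab
    rw [hMc.isClosed.mem_iff_infDist_zero hMn]
    refine le_antisymm (le_of_forall_pos_le_add fun ε hε => ?_) infDist_nonneg
    obtain ⟨j, hj⟩ := ((tendsto_iff_dist_tendsto_zero.1 hlim).eventually_lt_const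
      (half_pos hε)).exists
    have hj' : hausdorffDist (K (φ j) : Set E) ((↑) '' (M : Set (closedBall (0 : E) R))) < ε / 2 :=
      (hdist _).trans_lt hj
    obtain ⟨x', hx', hxx'⟩ := exists_dist_lt_of_hausdorffDist_lt' hx hj' (hfin _)
    obtain ⟨y', hy', hyy'⟩ := exists_dist_lt_of_hausdorffDist_lt' hy hj' (hfin _)
    have hz := (K (φ j)).convex hx' hy' ha hb hab
    have h1 := (infDist_le_hausdorffDist_of_mem hz (hfin _)).trans hj'.le
    have h2 : dist (a • x + b • y) (a • x' + b • y') ≤ ε / 2 := by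
      rw [dist_comm] at hxx' hyy'
      calc dist (a • x + b • y) (a • x' + b • y')
          ≤ dist (a • x) (a • x') + dist (b • y) (b • y') := dist_add_add_le _ _ _ _
        _ = a * dist x x' + b * dist y y' := by
          rw [dist_smul₀, dist_smul₀, Real.norm_of_nonneg ha, Real.norm_of_nonneg hb]
        _ ≤ a * (ε / 2) + b * (ε / 2) := by
          gcongr
        _ = ε / 2 := by rw [← add_mul, hab, one_mul]
    have h3 := infDist_le_infDist_add_dist (s := ((↑) '' (M : Set (closedBall (0 : E) R)) : Set E))
      (x := a • x + b • y) (y := a • x' + b • y')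
    linarith
  refine ⟨⟨_, hconv, hMc, hMn⟩, φ, hφ, tendsto_iff_dist_tendsto_zero.2 ?_⟩
  refine (tendsto_iff_dist_tendsto_zero.1 hlim).congr fun j => ?_
  exact (hdist _).symm

end Limit

/-! ### Centered balls: recognition and volume -/

section Ball

variable {n : ℕ}

theorem eq_centeredBall {L : ConvexBody (EuclideanSpace ℝ (Fin n))} {r : NNReal}
    (h : ∀ v, supp L v = r * ‖v‖) : L = centeredBall n r := by
  ext x
  change x ∈ L ↔ x ∈ closedBall (0 : EuclideanSpace ℝ (Fin n)) r
  rw [mem_closedBall_zero_iff]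
  constructor
  · intro hx
    have h1 := inner_le_supp hx x
    rw [h, real_inner_self_eq_norm_sq, sq] at h1
    rcases (norm_nonneg x).eq_or_lt with h0 | h0
    · rw [← h0]; exact r.2
    · exact le_of_mul_le_mul_right h1 h0
  · intro hx
    by_contra hxL
    obtain ⟨v, hv⟩ := exists_supp_lt_inner hxL
    rw [h] at hv
    have h1 := real_inner_le_norm x v
    have h2 : ‖x‖ * ‖v‖ ≤ r * ‖v‖ := by gcongr
    linarith

/-- A convex body whose support function is invariant under a dense set of reflections is a
centered ball. -/
theorem exists_eq_centeredBall (hn : 1 ≤ n)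
    {Ω : Set (sphere (0 : EuclideanSpace ℝ (Fin n)) 1)} (hΩ : Dense Ω)
    {L : ConvexBody (EuclideanSpace ℝ (Fin n))}
    (h : ∀ u ∈ Ω, ∀ v, supp L (refl u v) = supp L v) : ∃ r, L = centeredBall n r := by
  let e : EuclideanSpace ℝ (Fin n) := EuclideanSpace.single ⟨0, hn⟩ 1
  have he : ‖e‖ = 1 := by simp [e]
  obtain ⟨x, hx⟩ := L.nonempty
  have h0 : 0 ≤ supp L e := by
    have h1 := inner_le_supp hx e
    have h2 := inner_le_supp hx (-e)
    rw [supp_eq_of_refl_invariant hΩ h (norm_neg e), inner_neg_right] at h2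
    linarith
  refine ⟨⟨supp L e, h0⟩, eq_centeredBall fun v => ?_⟩
  change supp L v = supp L e * ‖v‖
  rcases eq_or_ne v 0 with rfl | hv
  · refine le_antisymm (supp_le fun y _ => by simp) ?_
    simpa using inner_le_supp hx (0 : EuclideanSpace ℝ (Fin n))
  · rw [supp_eq_of_refl_invariant hΩ h (w := ‖v‖ • e) (by simp [norm_smul, he]),
      supp_smul _ (norm_pos_iff.2 hv), mul_comm]

theorem volume_centeredBall (r : NNReal) :
    volume (centeredBall n r : Set (EuclideanSpace ℝ (Fin n))) =
      ENNReal.ofReal ((r : ℝ) ^ n) * volume (ball (0 : EuclideanSpace ℝ (Fin n)) 1) := by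
  have := Measure.addHaar_closedBall volume (0 : EuclideanSpace ℝ (Fin n)) r.2
  rwa [finrank_euclideanSpace_fin] at this

theorem volume_centeredBall_injective (hn : 1 ≤ n) {r s : NNReal}
    (h : volume (centeredBall n r : Set (EuclideanSpace ℝ (Fin n))) =
      volume (centeredBall n s : Set (EuclideanSpace ℝ (Fin n)))) : r = s := by
  rw [volume_centeredBall, volume_centeredBall,
    ENNReal.mul_left_inj (measure_ball_pos _ _ one_pos).ne' measure_ball_lt_top.ne,
    ENNReal.ofReal_eq_ofReal_iff (by positivity) (by positivity)] at h
  exact NNReal.coe_injective ((pow_left_inj₀ r.2 s.2 (by omega)).1 h)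

theorem subset_centeredBall {K : ConvexBody (EuclideanSpace ℝ (Fin n))} {r ε : NNReal}
    (h : dist K (centeredBall n r) ≤ ε) :
    (K : Set (EuclideanSpace ℝ (Fin n))) ⊆ centeredBall n (r + ε) := by
  intro x hx
  obtain ⟨y, hy, hxy⟩ := exists_dist_le K (centeredBall n r) hx
  have hy' : dist y 0 ≤ r := hy
  change dist x 0 ≤ ((r + ε : NNReal) : ℝ)
  push_cast
  linarith [dist_triangle x y 0]

/-- Otherwise a separating `v` gives `h_K(v) < r‖v‖`, whereas closeness to the larger ball gives
`h_K(v) ≥ (r + ε)‖v‖ - ε‖v‖`. -/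
theorem centeredBall_subset {K : ConvexBody (EuclideanSpace ℝ (Fin n))} {r ε : NNReal}
    (h : dist K (centeredBall n (r + ε)) ≤ ε) :
    (centeredBall n r : Set (EuclideanSpace ℝ (Fin n))) ⊆ K := by
  intro x hx
  by_contra hxK
  obtain ⟨v, hv⟩ := exists_supp_lt_inner hxK
  have hxr : ‖x‖ ≤ r := mem_closedBall_zero_iff.1 hx
  have h1 : supp (centeredBall n (r + ε)) v ≤ supp K v + ε * ‖v‖ := by
    refine supp_le_supp_add (fun y hy => ?_) v
    obtain ⟨z, hz, hyz⟩ := exists_dist_le _ K hy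
    exact ⟨z, hz, hyz.trans (by rwa [dist_comm])⟩
  have h2 : ((r : ℝ) + ε) * ‖v‖ ≤ supp (centeredBall n (r + ε)) v := by
    rcases eq_or_ne v 0 with rfl | hv0
    · simpa using inner_le_supp (centeredBall n (r + ε)).nonempty.some_mem
        (0 : EuclideanSpace ℝ (Fin n))
    · have hv0' : ‖v‖ ≠ 0 := norm_ne_zero_iff.2 hv0
      have hmem : (((r : ℝ) + ε) * ‖v‖⁻¹) • v ∈ centeredBall n (r + ε) := by
        refine mem_closedBall_zero_iff.2 ?_
        rw [norm_smul, Real.norm_of_nonneg (by positivity), inv_mul_cancel_right₀ hv0']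
        simp
      have h3 := inner_le_supp hmem v
      rw [real_inner_smul_left, real_inner_self_eq_norm_sq] at h3
      convert h3 using 1
      field_simp
  have h4 := real_inner_le_norm x v
  have h5 : ‖x‖ * ‖v‖ ≤ r * ‖v‖ := by gcongr
  linarith

/-- Volume passes to the Hausdorff limit when the limit is a centered ball. -/
theorem volume_eq_of_tendsto_centeredBall (hn : 1 ≤ n)
    {K : ℕ → ConvexBody (EuclideanSpace ℝ (Fin n))}
    {r : NNReal} (hK : Tendsto K atTop (𝓝 (centeredBall n r))) {V : ENNReal}
    (hV : ∀ j, volume (K j : Set (EuclideanSpace ℝ (Fin n))) = V) :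
    volume (centeredBall n r : Set (EuclideanSpace ℝ (Fin n))) = V := by
  have hcont : Continuous fun s : NNReal =>
      volume (centeredBall n s : Set (EuclideanSpace ℝ (Fin n))) := by
    simp only [volume_centeredBall]
    refine (ENNReal.continuous_mul_const measure_ball_lt_top.ne).comp
      (ENNReal.continuous_ofReal.comp (by fun_prop))
  have hnear : ∀ ε : NNReal, 0 < ε → ∃ j, dist (K j) (centeredBall n r) ≤ ε := fun ε hε =>
    let ⟨j, hj⟩ := ((tendsto_iff_dist_tendsto_zero.1 hK).eventually_lt_const
      (NNReal.coe_pos.2 hε)).exists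
    ⟨j, hj.le⟩
  apply le_antisymm
  -- A ball of radius zero has volume zero since `n ≥ 1`; otherwise every ball of radius `s < r`
  -- sits in some `K j`, and `s` tends to `r`.
  · rcases eq_or_ne r 0 with rfl | hr
    · rw [volume_centeredBall]
      simp [show n ≠ 0 by omega]
    · have : (𝓝[<] r).NeBot := nhdsLT_neBot_of_exists_lt ⟨0, pos_iff_ne_zero.2 hr⟩
      refine le_of_tendsto ((hcont.tendsto r).mono_left (nhdsWithin_le_nhds (s := Set.Iio r)))
        (eventually_mem_nhdsWithin.mono fun s hs => ?_)
      obtain ⟨ε, rfl⟩ := exists_add_of_le (Set.mem_Iio.1 hs).le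
      obtain ⟨j, hj⟩ := hnear ε (by simpa using hs)
      exact hV j ▸ measure_mono (centeredBall_subset hj)
  · have h1 : Tendsto (fun ε : NNReal =>
        volume (centeredBall n (r + ε) : Set (EuclideanSpace ℝ (Fin n)))) (𝓝[>] 0)
        (𝓝 (volume (centeredBall n r : Set (EuclideanSpace ℝ (Fin n))))) := by
      have : Continuous fun ε : NNReal =>
        volume (centeredBall n (r + ε) : Set (EuclideanSpace ℝ (Fin n))) :=
          hcont.comp (by fun_prop)
      simpa using (this.tendsto 0).mono_left nhdsWithin_le_nhds
    refine ge_of_tendsto h1 (eventually_mem_nhdsWithin.mono fun ε hε => ?_)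
    obtain ⟨j, hj⟩ := hnear ε hε
    exact hV j ▸ measure_mono (subset_centeredBall hj)

end Ball

/-! ### Greedy choice of directions -/

section Greedy

variable {E : Type*} [NormedAddCommGroup E] [InnerProductSpace ℝ E]

theorem norm_le_of_mem_iteratedSymmetral {K : ConvexBody E} {R : ℝ} (hK : ∀ x ∈ K, ‖x‖ ≤ R)
    (u : ℕ → sphere (0 : E) 1) (m : ℕ) : ∀ x ∈ iteratedSymmetral u K m, ‖x‖ ≤ R := by
  induction m with
  | zero => exact hK
  | succ m ih => exact norm_le_of_mem_symmetral ih

variable [FiniteDimensional ℝ E] [MeasurableSpace E] [BorelSpace E]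

theorem exists_almost_minimizing {Ω : Set (sphere (0 : E) 1)} (hΩ : Ω.Nonempty)
    (K : ConvexBody E) {ε : ℝ} (hε : 0 < ε) :
    ∃ u ∈ Ω, ∀ w ∈ Ω, expMean (symmetral u K) ≤ expMean (symmetral w K) + ε := by
  have hbdd : BddBelow ((fun u => expMean (symmetral u K)) '' Ω) :=
    ⟨0, by rintro _ ⟨u, -, rfl⟩; exact expMean_nonneg _⟩
  obtain ⟨_, ⟨u, hu, rfl⟩, hlt⟩ := exists_lt_of_csInf_lt
    (hΩ.image fun u => expMean (symmetral u K)) (lt_add_of_pos_right _ hε)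
  exact ⟨u, hu, fun w hw => hlt.le.trans (by gcongr; exact csInf_le hbdd ⟨w, hw, rfl⟩)⟩

/-- Directions from `Ω`, each of them almost minimizing `expMean` of the next symmetral. -/
theorem exists_greedy_directions {Ω : Set (sphere (0 : E) 1)} (hΩ : Ω.Nonempty)
    (K : ConvexBody E) :
    ∃ u : ℕ → sphere (0 : E) 1, (∀ i, u i ∈ Ω) ∧ ∀ m, ∀ w ∈ Ω,
      expMean (iteratedSymmetral u K (m + 1)) ≤
        expMean (symmetral w (iteratedSymmetral u K m)) + 1 / ((m : ℝ) + 1) := by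
  choose pick hpick hmin using fun (L : ConvexBody E) (m : ℕ) =>
    exists_almost_minimizing hΩ L (Nat.one_div_pos_of_nat (α := ℝ) (n := m))
  -- Each direction depends on the current body, so the bodies are built first and the directions
  -- read off.
  let body : ℕ → ConvexBody E := fun m => Nat.rec K (fun m L => symmetral (pick L m) L) m
  let u : ℕ → sphere (0 : E) 1 := fun m => pick (body m) m
  have hbody : ∀ m, iteratedSymmetral u K m = body m := fun m => by
    induction m with
    | zero => rfl
    | succ m ih => exact congrArg (symmetral (u m)) ih
  refine ⟨u, fun i => hpick _ _, fun m w hw => ?_⟩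
  rw [hbody, hbody]
  exact hmin (body m) m w hw

/-- At a subsequential limit of a greedy sequence, no direction of `Ω` decreases `expMean`. -/
theorem expMean_le_symmetral_of_tendsto {Ω : Set (sphere (0 : E) 1)}
    {K : ConvexBody E} {u : ℕ → sphere (0 : E) 1}
    (hu : ∀ m, ∀ w ∈ Ω, expMean (iteratedSymmetral u K (m + 1)) ≤
      expMean (symmetral w (iteratedSymmetral u K m)) + 1 / ((m : ℝ) + 1))
    {L : ConvexBody E} {φ : ℕ → ℕ} (hφ : Tendsto φ atTop atTop)
    (hL : Tendsto (fun j => iteratedSymmetral u K (φ j)) atTop (𝓝 L)) :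
    ∀ w ∈ Ω, expMean L ≤ expMean (symmetral w L) := by
  intro w hw
  have hanti : Antitone fun m => expMean (iteratedSymmetral u K m) :=
    antitone_nat_of_succ_le fun m => expMean_symmetral_le _ _
  have hlim := tendsto_expMean hL
  have hlow : ∀ m, expMean L ≤ expMean (iteratedSymmetral u K m) := fun m =>
    le_of_tendsto hlim ((hφ.eventually_ge_atTop m).mono fun j hj => hanti hj)
  have hbound : ∀ δ : ℝ, 0 < δ → expMean L ≤ Real.exp δ * expMean (symmetral w L) := by
    intro δ hδ
    have h0 : Tendsto (fun j => Real.exp δ * expMean (symmetral w L) + 1 / ((φ j : ℝ) + 1)) atTop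
        (𝓝 (Real.exp δ * expMean (symmetral w L) + 0)) :=
      tendsto_const_nhds.add (tendsto_one_div_add_atTop_nhds_zero_nat.comp hφ)
    rw [add_zero] at h0
    refine ge_of_tendsto h0 ((eventually_symmetral_subset w hL hδ).mono fun j hj => ?_)
    -- The step after `φ j` still has `expMean` at least that of `L`, and does almost as well as
    -- `w`, whose symmetral is `δ`-near that of `L`.
    exact (hlow (φ j + 1)).trans ((hu (φ j) w hw).trans (by gcongr; exact expMean_le hδ.le hj))
  have h1 : Tendsto (fun δ : ℝ => Real.exp δ * expMean (symmetral w L)) (𝓝[>] 0)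
      (𝓝 (expMean (symmetral w L))) := by
    have : Continuous fun δ : ℝ => Real.exp δ * expMean (symmetral w L) := by fun_prop
    simpa using (this.tendsto 0).mono_left nhdsWithin_le_nhds
  exact ge_of_tendsto h1 (eventually_mem_nhdsWithin.mono fun δ hδ => hbound δ hδ)

end Greedy

end Steiner

/-! ### Convergence of the whole sequence -/

theorem mainTheorem1 (n : ℕ) (hn : 1 ≤ n)
    (Ω : Set (Metric.sphere (0 : EuclideanSpace ℝ (Fin n)) 1)) (hΩ : Dense Ω)
    (K : ConvexBody (EuclideanSpace ℝ (Fin n))) :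
    ∃ u : ℕ → Metric.sphere (0 : EuclideanSpace ℝ (Fin n)) 1, (∀ i, u i ∈ Ω) ∧
      ∃ r : NNReal,
        MeasureTheory.volume (Steiner.centeredBall n r : Set (EuclideanSpace ℝ (Fin n))) =
          MeasureTheory.volume (K : Set (EuclideanSpace ℝ (Fin n))) ∧
        Filter.Tendsto (fun m => Steiner.iteratedSymmetral u K m) Filter.atTop
          (nhds (Steiner.centeredBall n r)) ∧
        (MeasureTheory.volume (K : Set (EuclideanSpace ℝ (Fin n))) = 0 →
          (Steiner.centeredBall n r : Set (EuclideanSpace ℝ (Fin n))) = {0}) := by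
  have hsphere : Nonempty (Metric.sphere (0 : EuclideanSpace ℝ (Fin n)) 1) :=
    ⟨⟨EuclideanSpace.single ⟨0, hn⟩ 1, by simp⟩⟩
  obtain ⟨u, huΩ, hu⟩ := Steiner.exists_greedy_directions hΩ.nonempty K
  obtain ⟨R, hR⟩ := K.isCompact.isBounded.exists_norm_le
  -- The radius may a priori depend on the subsequence; equality of volumes later shows that it does
  -- not.
  have hcluster : ∀ ns : ℕ → ℕ, Filter.Tendsto ns Filter.atTop Filter.atTop →
      ∃ (ms : ℕ → ℕ) (r : NNReal),
        MeasureTheory.volume (Steiner.centeredBall n r : Set (EuclideanSpace ℝ (Fin n))) =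
          MeasureTheory.volume (K : Set (EuclideanSpace ℝ (Fin n))) ∧
        Filter.Tendsto (fun j => Steiner.iteratedSymmetral u K (ns (ms j))) Filter.atTop
          (nhds (Steiner.centeredBall n r)) := by
    intro ns hns
    obtain ⟨L, ms, hms, hL⟩ := Steiner.exists_tendsto_subseq
      (fun j => Steiner.iteratedSymmetral u K (ns j))
      fun j => Steiner.norm_le_of_mem_iteratedSymmetral hR u (ns j)
    have hmin := Steiner.expMean_le_symmetral_of_tendsto hu (hns.comp hms.tendsto_atTop) hL
    obtain ⟨r, rfl⟩ := Steiner.exists_eq_centeredBall hn hΩ fun w hw =>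
      Steiner.supp_refl_of_expMean_le (hmin w hw)
    exact ⟨ms, r, Steiner.volume_eq_of_tendsto_centeredBall hn hL fun j =>
      Steiner.volume_iteratedSymmetral u K _, hL⟩
  obtain ⟨-, r, hr, -⟩ := hcluster id Filter.tendsto_id
  refine ⟨u, huΩ, r, hr, Filter.tendsto_of_subseq_tendsto fun ns hns => ?_, fun h0 => ?_⟩
  · obtain ⟨ms, s, hs, hlim⟩ := hcluster ns hns
    rw [Steiner.volume_centeredBall_injective hn (hr.trans hs.symm)]
    exact ⟨ms, hlim⟩
  · have hr0 : r = 0 := Steiner.volume_centeredBall_injective hn (by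
      rw [hr, h0, Steiner.volume_centeredBall]
      simp [show n ≠ 0 by omega])
    rw [hr0]
    exact Metric.closedBall_zero
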